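/- Let $d\ge n$ be positive integers, let $H_1,\dots,H_q\subseteq[d]=\{1,\dots,d\}$ ($q\ge 0$), and let $r_1,\dots,r_q$ be positive integers such that $$|H_i\cap H_j|\le r_i+r_j-n\ \ (i\ne j),\qquad |[d]\setminus H_i|\ge n-r_i,\qquad r_i\le n-1,\qquad |H_i|\ge r_i+1$$ for all $i,j\in[q]$. Let $M$ be the elementary split matroid of this hypergraph, that is, the matroid of rank $n$ on $[d]$ whose independent sets are the sets $X\subseteq[d]$ with $|X|\le n$ and $|X\cap H_i|\le r_i$ for all $i$. Call two circuits of $M$ of size at most $n$ equivalent if they have the same closure, and let $\mathcal L_M$ be the set of equivalence classes. For $l\in\mathcal L_M$ let $\operatorname{rk}(l)$ be the common rank of the circuits in $l$ and let $|l|$ be the number of elements of $[d]$ that lie in some circuit in $l$. The naive dimension of the realization space $\Gamma_M$ is $$\dim_{\mathrm{naive}}(\Gamma_M)=nd-\sum_{l\in\mathcal L_M}(|l|-\operatorname{rk}(l))(n-\operatorname{rk}(l)).$$ Define $a(S)$ for $S\subseteq[d]$ recursively by $a(S)=|S|-\operatorname{rk}(S)-\sum_{T\subsetneq S}a(T)$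 (so $a(\emptyset)=0$). The expected codimension (Ford) of $M$ is $\operatorname{ec}(M)=\sum_{S\subseteq[d]}(n-\operatorname{rk}(S))\,a(S)$, and its expected dimension is $\operatorname{ed}(M)=nd-\operatorname{ec}(M)$. Then $$\dim_{\mathrm{naive}}(\Gamma_M)=nd-\operatorname{ec}(M)=nd-\sum_{i=1}^q(n-r_i)(|H_i|-r_i).$$ In particular, the naive dimension and the expected dimension of $M$ coincide. -/

import Mathlib

/-! ### Ranks -/

/-- The rank of a set in a matroid, as a natural number. (Only used on finite ground types, where
the `ℕ∞`-valued rank is finite.) -/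
noncomputable def Matroid.natRk {α : Type*} (M : Matroid α) (X : Set α) : ℕ :=
  (M.eRk X).toNat

/-- The rank of a matroid, as a natural number. -/
noncomputable def Matroid.natRank {α : Type*} (M : Matroid α) : ℕ :=
  M.eRank.toNat

/-! ### Subspaces of a matroid and the naive dimension -/

/-- The circuits of `M` of size less than `rank M + 1`. -/
def SmallCircuit {α : Type*} (M : Matroid α) : Type _ :=
  {C : Set α // M.IsCircuit C ∧ C.ncard < M.natRank + 1}

/-- Two circuits of size at most `rank M` are equivalent when they have the same closure. -/
def smallCircuitSetoid {α : Type*} (M : Matroid α) : Setoid (SmallCircuit M) where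
  r C₁ C₂ := M.closure C₁.1 = M.closure C₂.1
  iseqv := ⟨fun _ => rfl, fun h => h.symm, fun h₁ h₂ => h₁.trans h₂⟩

/-- A subspace of `M` is an equivalence class of circuits of size at most `rank M`. -/
def MatroidSubspace {α : Type*} (M : Matroid α) : Type _ :=
  Quotient (smallCircuitSetoid M)

/-- The points that belong to a subspace: those lying on some circuit of the class. -/
def MatroidSubspace.points {α : Type*} {M : Matroid α} (l : MatroidSubspace M) : Set α :=
  {p | ∃ C : SmallCircuit M, Quotient.mk (smallCircuitSetoid M) C = l ∧ p ∈ C.1}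

/-- The rank of a subspace: the common rank of the circuits in the class. -/
noncomputable def MatroidSubspace.rank {α : Type*} {M : Matroid α} (l : MatroidSubspace M) : ℕ :=
  Quotient.lift (fun C : SmallCircuit M => M.natRk C.1)
    (fun C₁ C₂ (h : M.closure C₁.1 = M.closure C₂.1) => by
      simp only [Matroid.natRk]
      rw [← M.eRk_closure_eq C₁.1, h, M.eRk_closure_eq]) l

noncomputable instance MatroidSubspace.instFintype {α : Type*} [Finite α] (M : Matroid α) :
    Fintype (MatroidSubspace M) :=
  haveI : Finite (SmallCircuit M) := Subtype.finite
  haveI : Finite (MatroidSubspace M) := Quotient.finite _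
  Fintype.ofFinite _

/-- The naive dimension of the realization space of `M`:
`n d - ∑_l (|l| - rank l) (n - rank l)`, where `n = rank M`, `d` is the number of elements of `M`
and `l` runs over the subspaces of `M`. -/
noncomputable def naiveDim {α : Type*} [Finite α] (M : Matroid α) : ℤ :=
  (M.natRank : ℤ) * (M.E.ncard : ℤ) -
    ∑ l : MatroidSubspace M,
      ((l.points.ncard : ℤ) - (l.rank : ℤ)) * ((M.natRank : ℤ) - (l.rank : ℤ))

/-! ### Expected codimension and expected dimension -/

/-- `c(S) = |S| - rank S`. -/
noncomputable def fordC {α : Type*} (M : Matroid α) (S : Finset α) : ℤ :=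
  (S.card : ℤ) - (M.natRk (S : Set α) : ℤ)

open Classical in
/-- The recursion `a_G(S) = c(S) - ∑_{T ∈ G, T ⊊ S} a_G(T)`. For `S = ∅` the sum is empty and
`c(∅) = 0`, so `a_G(∅) = 0`. -/
noncomputable def fordA {α : Type*} (M : Matroid α) (G : Finset (Finset α)) (S : Finset α) : ℤ :=
  fordC M S - ∑ T : {T : Finset α // T ∈ G.filter (fun T => T ⊂ S)}, fordA M G T.1
termination_by S.card
decreasing_by exact Finset.card_lt_card (Finset.mem_filter.1 T.2).2

/-- The expected codimension of `M` with respect to a collection `G` of subsets. -/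
noncomputable def expectedCodimWrt {α : Type*} (M : Matroid α) (G : Finset (Finset α)) : ℤ :=
  ∑ S ∈ G, ((M.natRank : ℤ) - (M.natRk (S : Set α) : ℤ)) * fordA M G S

open Classical in
/-- The expected codimension of `M`: take for `G` all subsets of the ground set. -/
noncomputable def expectedCodim {α : Type*} [Fintype α] (M : Matroid α) : ℤ :=
  expectedCodimWrt M (Finset.univ.filter (fun S : Finset α => (S : Set α) ⊆ M.E))

/-- The expected dimension of `M`: `n d - ec(M)`. -/
noncomputable def expectedDim {α : Type*} [Fintype α] (M : Matroid α) : ℤ :=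
  (M.natRank : ℤ) * (M.E.ncard : ℤ) - expectedCodim M

/-! ### Elementary split matroids -/

/-- The conditions on a hypergraph `H_1, …, H_q` on `[d]` and integers `r_1, …, r_q` under which
they define an elementary split matroid of rank `n`. The inequalities that involve subtraction are
written additively. -/
structure IsElementarySplitData (n d : ℕ) {q : ℕ} (H : Fin q → Finset (Fin d)) (r : Fin q → ℕ) :
    Prop where
  n_pos : 0 < n
  n_le : n ≤ d
  r_pos : ∀ i, 0 < r i
  /-- `|H_i ∩ H_j| ≤ r_i + r_j - n` for distinct `i`, `j` -/
  inter : ∀ i j, i ≠ j → (H i ∩ H j).card + n ≤ r i + r j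
  /-- `|[d] \ H_i| ≥ n - r_i` -/
  compl : ∀ i, n ≤ (H i)ᶜ.card + r i
  /-- `r_i ≤ n - 1` -/
  r_lt : ∀ i, r i + 1 ≤ n
  card : ∀ i, r i + 1 ≤ (H i).card

/-- The independent sets of the elementary split matroid. -/
def ElementarySplitIndep (n : ℕ) {d q : ℕ} (H : Fin q → Finset (Fin d)) (r : Fin q → ℕ)
    (X : Finset (Fin d)) : Prop :=
  X.card ≤ n ∧ ∀ i, (X ∩ H i).card ≤ r i

theorem ElementarySplitIndep.aug {n d q : ℕ} {H : Fin q → Finset (Fin d)} {r : Fin q → ℕ}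
    (h : IsElementarySplitData n d H r) ⦃I J : Finset (Fin d)⦄
    (hI : ElementarySplitIndep n H r I) (hJ : ElementarySplitIndep n H r J)
    (hIJ : I.card < J.card) :
    ∃ e ∈ J, e ∉ I ∧ ElementarySplitIndep n H r (insert e I) := by
  by_contra hcon
  push Not at hcon
  have hIn : I.card < n := lt_of_lt_of_le hIJ hJ.1
  have key : ∀ e ∈ J, e ∉ I → ∃ i, e ∈ H i ∧ r i ≤ (I ∩ H i).card := by
    intro e heJ heI
    by_contra hc
    push Not at hc
    refine hcon e heJ heI ⟨?_, fun i => ?_⟩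
    · rw [Finset.card_insert_of_notMem heI]; omega
    · by_cases hei : e ∈ H i
      · rw [Finset.insert_inter_of_mem hei]
        have h1 := Finset.card_insert_le e (I ∩ H i)
        have h2 := hc i hei
        omega
      · rw [Finset.insert_inter_of_notMem hei]
        exact hI.2 i
  have uniq : ∀ i j, r i ≤ (I ∩ H i).card → r j ≤ (I ∩ H j).card → i = j := by
    intro i j hi hj
    by_contra hij
    have h1 := h.inter i j hij
    have h2 := Finset.card_union_add_card_inter (I ∩ H i) (I ∩ H j)
    have h3 : ((I ∩ H i) ∪ (I ∩ H j)).card ≤ I.card :=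
      Finset.card_le_card (Finset.union_subset Finset.inter_subset_left Finset.inter_subset_left)
    have h4 : ((I ∩ H i) ∩ (I ∩ H j)).card ≤ (H i ∩ H j).card :=
      Finset.card_le_card (Finset.inter_subset_inter Finset.inter_subset_right
        Finset.inter_subset_right)
    omega
  have hne : (J \ I).Nonempty := by
    rw [Finset.sdiff_nonempty]
    intro hs
    exact absurd (Finset.card_le_card hs) (by omega)
  obtain ⟨e, he⟩ := hne
  rw [Finset.mem_sdiff] at he
  obtain ⟨i, -, hi⟩ := key e he.1 he.2
  have hsub : J \ I ⊆ H i := by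
    intro x hx
    rw [Finset.mem_sdiff] at hx
    obtain ⟨j, hxj, hj⟩ := key x hx.1 hx.2
    rwa [uniq i j hi hj]
  have h1 : J ∩ H i = (J \ I) ∪ (I ∩ J ∩ H i) := by
    ext x
    have := @hsub x
    simp only [Finset.mem_sdiff, Finset.mem_inter, Finset.mem_union] at this ⊢
    tauto
  have h2 : Disjoint (J \ I) (I ∩ J ∩ H i) := by
    rw [Finset.disjoint_left]
    intro x hx hx'
    simp only [Finset.mem_sdiff, Finset.mem_inter] at hx hx'
    exact hx.2 hx'.1.1
  have h3 : (J ∩ H i).card = (J \ I).card + (I ∩ J ∩ H i).card := by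
    rw [h1, Finset.card_union_of_disjoint h2]
  have h4 : (I ∩ H i).card ≤ (I \ J).card + (I ∩ J ∩ H i).card := by
    refine le_trans (Finset.card_le_card ?_) (Finset.card_union_le _ _)
    intro x hx
    simp only [Finset.mem_sdiff, Finset.mem_inter, Finset.mem_union] at hx ⊢
    tauto
  have h5 := Finset.card_sdiff_add_card_inter I J
  have h6 := Finset.card_sdiff_add_card_inter J I
  rw [Finset.inter_comm J I] at h6
  have h7 := hJ.2 i
  omega

/-- The elementary split matroid of rank `n` on `[d]` of the hypergraph `H_1, …, H_q` with ranks
`r_1, …, r_q`: its independent sets are the `X ⊆ [d]` with `|X| ≤ n` and `|X ∩ H_i| ≤ r_i` for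
all `i`. -/
def elementarySplitMatroid {n d q : ℕ} {H : Fin q → Finset (Fin d)} {r : Fin q → ℕ}
    (h : IsElementarySplitData n d H r) : Matroid (Fin d) :=
  (IndepMatroid.ofFinset Set.univ (ElementarySplitIndep n H r)
    ⟨by simp, by simp⟩
    (fun _ _ hJ hIJ => ⟨(Finset.card_le_card hIJ).trans hJ.1, fun i =>
      (Finset.card_le_card (Finset.inter_subset_inter_right hIJ)).trans (hJ.2 i)⟩)
    (ElementarySplitIndep.aug h)
    (fun _ _ => Set.subset_univ _)).matroid

/-! ### Ranks of finite sets -/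

/-! The bound `|H i ∩ H j| ≤ r i + r j - n` prevents an independent set of size below `n` from being
full on two hyperedges. Hence a dependent set `S` of rank below `n` overfills exactly one `H i` and
has rank `|S \ H i| + r i` (`elementarySplitMatroid_exists_of_not_indep`).

Naive dimension: the circuits of size at most `n` are the `(r i + 1)`-subsets of the `H i`, and each
has closure `H i`. So the classes correspond to the indices `i`, with point set `H i` and rank `r
i`.

Expected codimension: sets of rank `n` have weight zero, and `a` vanishes on independent sets and on
sets of rank below `n` that are not overfull subsets of some `H i`
(`elementarySplitMatroid_fordA_eq_zero`). The overfull subsets of `H i` all have weight `n - r i`,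
and their coefficients add up to the nullity `|H i| - r i`. Both computations give the same sum. -/

theorem Matroid.card_le_natRk_of_indep {α : Type*} {M : Matroid α} {I S : Finset α}
    (hI : M.Indep (I : Set α)) (hIS : I ⊆ S) : I.card ≤ M.natRk (S : Set α) := by
  have h1 := hI.encard_le_eRk_of_subset (Finset.coe_subset.2 hIS)
  have h2 : M.eRk (S : Set α) ≠ ⊤ :=
    ne_top_of_le_ne_top (by simp) (M.eRk_le_encard (S : Set α))
  simpa [Matroid.natRk] using ENat.toNat_le_toNat h1 h2

theorem Matroid.exists_finset_maximal_indep {α : Type*} [DecidableEq α] (M : Matroid α)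
    (S : Finset α) :
    ∃ I ⊆ S, M.Indep (I : Set α) ∧ I.card = M.natRk (S : Set α) ∧
      ∀ e ∈ S, e ∉ I → ¬ M.Indep (insert e I : Finset α) := by
  obtain ⟨B, hB⟩ := M.exists_isBasis' (S : Set α)
  lift B to Finset α using S.finite_toSet.subset hB.subset
  refine ⟨B, Finset.coe_subset.1 hB.subset, hB.indep, ?_, fun e he heB hins => ?_⟩
  · rw [Matroid.natRk, hB.eRk_eq_encard]
    simp
  · rw [Finset.coe_insert] at hins
    exact heB (Finset.mem_coe.1 (hB.mem_of_insert_indep (Finset.mem_coe.2 he) hins))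

theorem Matroid.natRk_of_indep {α : Type*} {M : Matroid α} {I : Finset α}
    (hI : M.Indep (I : Set α)) : M.natRk (I : Set α) = I.card := by
  rw [Matroid.natRk, hI.eRk_eq_encard]
  simp

/-! ### The coefficients `a(S)` over all subsets -/

/-- Möbius inversion on the Boolean lattice; the recursion for `a` is used below only in this form.
-/
theorem fordA_univ_sum_powerset {α : Type*} [Fintype α] [DecidableEq α] (M : Matroid α)
    (S : Finset α) : ∑ T ∈ S.powerset, fordA M Finset.univ T = fordC M S := by
  have h1 : fordA M Finset.univ S = fordC M S - ∑ T ∈ S.ssubsets, fordA M Finset.univ T := by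
    rw [fordA.eq_1, Finset.sum_coe_sort _ (fordA M Finset.univ)]
    congr 2
    ext T
    simp
  rw [← Finset.sum_erase_add _ _ (Finset.mem_powerset_self S), h1]
  exact add_sub_cancel _ _

theorem fordA_eq_zero_of_indep {α : Type*} [Fintype α] (M : Matroid α) (S : Finset α)
    (hS : M.Indep (S : Set α)) : fordA M Finset.univ S = 0 := by
  classical
  induction S using Finset.strongInduction with
  | H S ih =>
    have h1 := fordA_univ_sum_powerset M S
    rw [← Finset.sum_erase_add _ _ (Finset.mem_powerset_self S), Finset.sum_eq_zero, zero_add,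
      fordC, Matroid.natRk_of_indep hS, sub_self] at h1
    · exact h1
    · intro T hT
      have hTS : T ⊂ S := Finset.mem_ssubsets.1 hT
      exact ih T hTS (hS.subset (Finset.coe_subset.2 hTS.subset))

/-! ### The rank function of an elementary split matroid -/

section ElementarySplit

variable {n d q : ℕ} {H : Fin q → Finset (Fin d)} {r : Fin q → ℕ}
  (h : IsElementarySplitData n d H r)

theorem elementarySplitMatroid_ground : (elementarySplitMatroid h).E = Set.univ := rfl

theorem elementarySplitMatroid_indep_iff {I : Finset (Fin d)} :
    (elementarySplitMatroid h).Indep (I : Set (Fin d)) ↔ ElementarySplitIndep n H r I := by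
  rw [elementarySplitMatroid, IndepMatroid.matroid_Indep]
  exact IndepMatroid.ofFinset_indep _ _ _ _ _ _

theorem ElementarySplitIndep.exists_tight {I : Finset (Fin d)} {e : Fin d}
    (hI : ElementarySplitIndep n H r I) (hn : I.card < n)
    (he : ¬ ElementarySplitIndep n H r (insert e I)) :
    ∃ i, e ∈ H i ∧ (I ∩ H i).card = r i := by
  by_contra! hc
  refine he ⟨(Finset.card_insert_le e I).trans hn, fun i => ?_⟩
  by_cases hei : e ∈ H i
  · rw [Finset.insert_inter_of_mem hei]
    have h1 := Finset.card_insert_le e (I ∩ H i)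
    have h2 := hc i hei
    have h3 := hI.2 i
    omega
  · rw [Finset.insert_inter_of_notMem hei]
    exact hI.2 i

/-- Two traces on distinct hyperedges that reach the prescribed ranks have a union of size at
least `n`. -/
theorem IsElementarySplitData.le_card_of_le_card_inter (h : IsElementarySplitData n d H r)
    {S : Finset (Fin d)} {i j : Fin q}
    (hij : i ≠ j) (hi : r i ≤ (S ∩ H i).card) (hj : r j ≤ (S ∩ H j).card) : n ≤ S.card := by
  have h1 := h.inter i j hij
  have h2 := Finset.card_union_add_card_inter (S ∩ H i) (S ∩ H j)
  have h3 : ((S ∩ H i) ∪ (S ∩ H j)).card ≤ S.card :=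
    Finset.card_le_card (Finset.union_subset Finset.inter_subset_left Finset.inter_subset_left)
  have h4 : ((S ∩ H i) ∩ (S ∩ H j)).card ≤ (H i ∩ H j).card :=
    Finset.card_le_card (Finset.inter_subset_inter Finset.inter_subset_right
      Finset.inter_subset_right)
  omega

/-- For `i ≠ j`, `|S| ≤ |H i ∩ H j| ≤ r i + r j - n < r i`, since `r j < n`. -/
theorem IsElementarySplitData.eq_of_subset (h : IsElementarySplitData n d H r)
    {S : Finset (Fin d)} {i j : Fin q}
    (hi : S ⊆ H i) (hj : S ⊆ H j) (hS : r i ≤ S.card) : i = j := by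
  by_contra hij
  have h1 := h.inter i j hij
  have h2 := Finset.card_le_card (Finset.subset_inter hi hj)
  have h3 := h.r_lt j
  omega

/-- A set meeting `H i` in at most `r i` elements, with at most one element outside `H i`, is
independent. -/
theorem IsElementarySplitData.indep_of_card_inter_le (h : IsElementarySplitData n d H r)
    {S : Finset (Fin d)} {i : Fin q}
    (hi : (S ∩ H i).card ≤ r i) (hS : (S \ H i).card ≤ 1) : ElementarySplitIndep n H r S := by
  have h0 := h.r_lt i
  have h1 := Finset.card_sdiff_add_card_inter S (H i)
  refine ⟨by omega, fun j => ?_⟩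
  by_cases hij : i = j
  · exact hij ▸ hi
  · have h2 := h.inter i j hij
    have h3 : (S ∩ H j).card ≤ (S \ H i).card + (H i ∩ H j).card := by
      refine le_trans (Finset.card_le_card ?_) (Finset.card_union_le _ _)
      intro x hx
      simp only [Finset.mem_sdiff, Finset.mem_inter, Finset.mem_union] at hx ⊢
      tauto
    omega

theorem IsElementarySplitData.indep_of_subset (h : IsElementarySplitData n d H r)
    {S : Finset (Fin d)} {i : Fin q}
    (hi : S ⊆ H i) (hS : S.card ≤ r i) : ElementarySplitIndep n H r S :=
  h.indep_of_card_inter_le ((Finset.card_le_card Finset.inter_subset_left).trans hS)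
    (by simp [Finset.sdiff_eq_empty_iff_subset.2 hi])

theorem elementarySplitMatroid_natRk_of_subset {S : Finset (Fin d)} {i : Fin q}
    (hi : S ⊆ H i) (hS : r i ≤ S.card) :
    (elementarySplitMatroid h).natRk (S : Set (Fin d)) = r i := by
  apply le_antisymm
  · obtain ⟨I, hIS, hI, hcard, -⟩ := (elementarySplitMatroid h).exists_finset_maximal_indep S
    have h1 := ((elementarySplitMatroid_indep_iff h).1 hI).2 i
    rwa [Finset.inter_eq_left.2 (hIS.trans hi), hcard] at h1
  · obtain ⟨T, hTS, hT⟩ := Finset.exists_subset_card_eq hS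
    rw [← hT]
    exact Matroid.card_le_natRk_of_indep
      ((elementarySplitMatroid_indep_iff h).2 (h.indep_of_subset (hTS.trans hi) hT.le)) hTS

/-- A dependent set of rank less than `n` exceeds the prescribed rank on exactly one hyperedge,
which determines its rank. -/
theorem elementarySplitMatroid_exists_of_not_indep {S : Finset (Fin d)}
    (hn : (elementarySplitMatroid h).natRk (S : Set (Fin d)) < n)
    (hS : ¬ ElementarySplitIndep n H r S) :
    ∃ i, r i < (S ∩ H i).card ∧
      (elementarySplitMatroid h).natRk (S : Set (Fin d)) = (S \ H i).card + r i ∧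
      ∀ j, r j < (S ∩ H j).card → j = i := by
  obtain ⟨I, hIS, hI, hcard, hmax⟩ := (elementarySplitMatroid h).exists_finset_maximal_indep S
  rw [elementarySplitMatroid_indep_iff] at hI
  simp only [elementarySplitMatroid_indep_iff] at hmax
  rw [← hcard] at hn ⊢
  have hne : (S \ I).Nonempty := by
    rw [Finset.sdiff_nonempty]
    exact fun hSI => hS (hIS.antisymm hSI ▸ hI)
  obtain ⟨e, he⟩ := hne
  obtain ⟨heS, heI⟩ := Finset.mem_sdiff.1 he
  obtain ⟨i, hei, hi⟩ := hI.exists_tight hn (hmax e heS heI)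
  -- Every element of `S \ I` is blocked by a full hyperedge; a second one would force `|I| ≥ n`.
  have hsub : S \ I ⊆ H i := by
    intro x hx
    obtain ⟨hxS, hxI⟩ := Finset.mem_sdiff.1 hx
    obtain ⟨j, hxj, hj⟩ := hI.exists_tight hn (hmax x hxS hxI)
    by_cases hij : i = j
    · exact hij ▸ hxj
    · have := h.le_card_of_le_card_inter hij hi.ge hj.ge
      omega
  have hout : S \ H i = I \ H i := by
    ext x
    have h1 := @hsub x
    have h2 := @hIS x
    simp only [Finset.mem_sdiff] at h1 ⊢
    tauto
  have hcardI := Finset.card_sdiff_add_card_inter I (H i)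
  refine ⟨i, ?_, by rw [hout]; omega, fun j hj => ?_⟩
  · rw [← hi]
    refine Finset.card_lt_card ⟨Finset.inter_subset_inter_right hIS, fun hc => ?_⟩
    exact heI (Finset.mem_inter.1 (hc (Finset.mem_inter.2 ⟨heS, hei⟩))).1
  -- `|S ∩ H j| ≤ |I \ H i| + |H j ∩ H i| ≤ (|I| - r i) + (r i + r j - n) < r j`.
  · by_contra hji
    have h1 := h.inter j i hji
    have h2 : (S ∩ H j).card ≤ (I \ H i).card + (H j ∩ H i).card := by
      refine le_trans (Finset.card_le_card ?_) (Finset.card_union_le _ _)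
      rw [← hout]
      intro x hx
      simp only [Finset.mem_sdiff, Finset.mem_inter, Finset.mem_union] at hx ⊢
      tauto
    omega

theorem elementarySplitMatroid_natRank : (elementarySplitMatroid h).natRank = n := by
  have hrank : (elementarySplitMatroid h).natRank =
      (elementarySplitMatroid h).natRk ((Finset.univ : Finset (Fin d)) : Set (Fin d)) := by
    rw [Matroid.natRank, Matroid.natRk, Finset.coe_univ, Matroid.eRk_univ_eq]
  rw [hrank]
  apply le_antisymm
  · obtain ⟨I, -, hI, hcard, -⟩ :=
      (elementarySplitMatroid h).exists_finset_maximal_indep Finset.univ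
    rw [← hcard]
    exact ((elementarySplitMatroid_indep_iff h).1 hI).1
  · by_contra! hlt
    by_cases hind : ElementarySplitIndep n H r Finset.univ
    · rw [Matroid.natRk_of_indep ((elementarySplitMatroid_indep_iff h).2 hind)] at hlt
      have := h.n_le
      simp only [Finset.card_univ, Fintype.card_fin] at hlt
      omega
    -- The rank would be `|(H i)ᶜ| + r i`, which `compl` makes at least `n`.
    · obtain ⟨i, -, hi, -⟩ := elementarySplitMatroid_exists_of_not_indep h hlt hind
      have h1 := h.compl i
      rw [Finset.compl_eq_univ_sdiff] at h1
      omega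

/-! ### Circuits and closures -/

/-- An `r i`-subset `T` of `S` stays independent when a point outside `H i` is added and becomes
dependent with a new point inside, so its closure is `H i`; then `S` lies between `T` and its
closure. -/
theorem elementarySplitMatroid_closure_of_subset {S : Finset (Fin d)} {i : Fin q}
    (hi : S ⊆ H i) (hS : r i ≤ S.card) :
    (elementarySplitMatroid h).closure (S : Set (Fin d)) = H i := by
  obtain ⟨T, hTS, hT⟩ := Finset.exists_subset_card_eq hS
  have hTi := hTS.trans hi
  have hTind := (elementarySplitMatroid_indep_iff h).2 (h.indep_of_subset hTi hT.le)
  have key : ∀ e : Fin d, e ∈ (elementarySplitMatroid h).closure (T : Set (Fin d)) ↔ e ∈ H i := by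
    intro e
    by_cases heT : e ∈ T
    · exact ⟨fun _ => hTi heT, fun _ => Matroid.mem_closure_of_mem' _ (Finset.mem_coe.2 heT)⟩
    · rw [hTind.mem_closure_iff_of_notMem (by simpa using heT), ← Finset.coe_insert,
        ← Matroid.not_indep_iff (by simp [elementarySplitMatroid_ground]),
        elementarySplitMatroid_indep_iff]
      constructor
      · intro hdep
        by_contra hei
        refine hdep (h.indep_of_card_inter_le (i := i) ?_ ?_)
        · rw [Finset.insert_inter_of_notMem hei]
          exact (Finset.card_le_card Finset.inter_subset_left).trans hT.le
        · rw [Finset.insert_sdiff_of_notMem _ hei, Finset.sdiff_eq_empty_iff_subset.2 hTi]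
          simp
      · intro hei hind
        have h1 := hind.2 i
        rw [Finset.inter_eq_left.2 (Finset.insert_subset hei hTi),
          Finset.card_insert_of_notMem heT] at h1
        omega
  have hTcl : (elementarySplitMatroid h).closure (T : Set (Fin d)) = H i := by
    ext e
    simpa using key e
  apply subset_antisymm
  · rw [← hTcl, ← (elementarySplitMatroid h).closure_closure (T : Set (Fin d))]
    apply Matroid.closure_subset_closure
    rw [hTcl]
    exact_mod_cast hi
  · rw [← hTcl]
    exact Matroid.closure_subset_closure _ (by exact_mod_cast hTS)

theorem elementarySplitMatroid_isCircuit_of_subset {C : Finset (Fin d)} {i : Fin q}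
    (hi : C ⊆ H i) (hC : C.card = r i + 1) :
    (elementarySplitMatroid h).IsCircuit (C : Set (Fin d)) := by
  rw [Matroid.isCircuit_iff_forall_ssubset,
    ← Matroid.not_indep_iff (by simp [elementarySplitMatroid_ground]),
    elementarySplitMatroid_indep_iff]
  refine ⟨fun hind => ?_, fun I hI => ?_⟩
  · have h1 := hind.2 i
    rw [Finset.inter_eq_left.2 hi] at h1
    omega
  · lift I to Finset (Fin d) using Set.toFinite I
    rw [Finset.coe_ssubset] at hI
    have h1 := Finset.card_lt_card hI
    exact (elementarySplitMatroid_indep_iff h).2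
      (h.indep_of_subset (hI.subset.trans hi) (by omega))

theorem elementarySplitMatroid_exists_of_isCircuit {C : Finset (Fin d)}
    (hC : (elementarySplitMatroid h).IsCircuit (C : Set (Fin d))) (hn : C.card ≤ n) :
    ∃ i, C ⊆ H i ∧ C.card = r i + 1 := by
  have hdep := hC.not_indep
  rw [elementarySplitMatroid_indep_iff] at hdep
  have hex : ∃ i, r i < (C ∩ H i).card := by
    by_contra! hc
    exact hdep ⟨hn, hc⟩
  obtain ⟨i, hi⟩ := hex
  -- Any `r i + 1` elements of `C ∩ H i` already form a circuit, so they exhaust `C`.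
  obtain ⟨T, hTC, hT⟩ := Finset.exists_subset_card_eq (Nat.succ_le_of_lt hi)
  have hTcirc := elementarySplitMatroid_isCircuit_of_subset h (hTC.trans Finset.inter_subset_right) hT
  have hTC' : T = C := by
    exact_mod_cast hTcirc.eq_of_subset_isCircuit hC
      (Finset.coe_subset.2 (hTC.trans Finset.inter_subset_left))
  rw [← hTC']
  exact ⟨i, hTC.trans Finset.inter_subset_right, hT⟩

/-! ### The naive dimension -/

theorem elementarySplitMatroid_sum_subspaces :
    ∑ l : MatroidSubspace (elementarySplitMatroid h),
      ((l.points.ncard : ℤ) - (l.rank : ℤ)) *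
        (((elementarySplitMatroid h).natRank : ℤ) - (l.rank : ℤ)) =
      ∑ i : Fin q, ((n : ℤ) - (r i : ℤ)) * (((H i).card : ℤ) - (r i : ℤ)) := by
  set M := elementarySplitMatroid h with hM
  have hrank : M.natRank = n := elementarySplitMatroid_natRank h
  have small : ∀ {C : Finset (Fin d)} {i : Fin q}, C ⊆ H i → C.card = r i + 1 →
      M.IsCircuit (C : Set (Fin d)) ∧ (C : Set (Fin d)).ncard < M.natRank + 1 := by
    intro C i hi hC
    refine ⟨elementarySplitMatroid_isCircuit_of_subset h hi hC, ?_⟩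
    have := h.r_lt i
    rw [Set.ncard_coe_finset, hrank]
    omega
  choose C hCsub hCcard using fun i => Finset.exists_subset_card_eq (h.card i)
  let f : Fin q → MatroidSubspace M := fun i =>
    Quotient.mk (smallCircuitSetoid M) ⟨C i, small (hCsub i) (hCcard i)⟩
  have hcl : ∀ {D : Finset (Fin d)} {i : Fin q}, D ⊆ H i → D.card = r i + 1 →
      M.closure (D : Set (Fin d)) = H i := fun hi hD =>
    elementarySplitMatroid_closure_of_subset h hi (by omega)
  have hmk : ∀ (D : SmallCircuit M) (i : Fin q),
      Quotient.mk (smallCircuitSetoid M) D = f i ↔ M.closure D.1 = H i := by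
    intro D i
    rw [← hcl (hCsub i) (hCcard i)]
    exact Quotient.eq (r := smallCircuitSetoid M)
  have hex : ∀ D : SmallCircuit M, ∃ (D' : Finset (Fin d)) (i : Fin q),
      D.1 = D' ∧ D' ⊆ H i ∧ D'.card = r i + 1 := by
    rintro ⟨D, hD, hDn⟩
    lift D to Finset (Fin d) using Set.toFinite D
    rw [Set.ncard_coe_finset, hrank] at hDn
    obtain ⟨i, hi, hc⟩ := elementarySplitMatroid_exists_of_isCircuit h hD (by omega)
    exact ⟨D, i, rfl, hi, hc⟩
  have hinj : Function.Injective H := by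
    intro i j hij
    have := h.card i
    exact h.eq_of_subset subset_rfl hij.subset (by omega)
  have hbij : Function.Bijective f := by
    constructor
    · intro i j hij
      have h1 := (hmk _ j).1 hij
      dsimp only at h1
      rw [hcl (hCsub i) (hCcard i)] at h1
      exact hinj (by exact_mod_cast h1)
    · intro l
      obtain ⟨D, rfl⟩ := Quotient.exists_rep l
      obtain ⟨D', i, hD, hi, hc⟩ := hex D
      exact ⟨i, ((hmk D i).2 (by rw [hD, hcl hi hc])).symm⟩
  have hpoints : ∀ i, (f i).points = H i := by
    intro i
    ext p
    constructor
    · rintro ⟨D, hD, hp⟩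
      rw [← (hmk D i).1 hD]
      exact M.mem_closure_of_mem hp D.2.1.subset_ground
    · intro hp
      obtain ⟨D, hpD, hDi, hD⟩ := Finset.exists_subsuperset_card_eq
        (Finset.singleton_subset_iff.2 (Finset.mem_coe.1 hp))
        (by simp : ({p} : Finset (Fin d)).card ≤ r i + 1) (h.card i)
      exact ⟨⟨D, small hDi hD⟩, (hmk _ i).2 (hcl hDi hD),
        Finset.mem_coe.2 (hpD (Finset.mem_singleton_self p))⟩
  have hrk : ∀ i, (f i).rank = r i := fun i =>
    elementarySplitMatroid_natRk_of_subset h (hCsub i) (by rw [hCcard i]; omega)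
  refine (Fintype.sum_bijective f hbij _ _ fun i => ?_).symm
  rw [hpoints, hrk, hrank, Set.ncard_coe_finset, mul_comm]

/-! ### The expected codimension -/

/-- If `H i` is the one overfull hyperedge of a dependent `S`, then by induction only subsets of `S
∩ H i` contribute to the recursion. They sum to the nullity `|S ∩ H i| - r i`, which equals that of
`S`, leaving `a(S) = 0`. -/
theorem elementarySplitMatroid_fordA_eq_zero (S : Finset (Fin d))
    (hn : (elementarySplitMatroid h).natRk (S : Set (Fin d)) < n)
    (hS : ∀ i, S ⊆ H i → S.card ≤ r i) :
    fordA (elementarySplitMatroid h) Finset.univ S = 0 := by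
  induction S using Finset.strongInduction with
  | H S ih =>
    set M := elementarySplitMatroid h with hM
    by_cases hind : ElementarySplitIndep n H r S
    · exact fordA_eq_zero_of_indep M S ((elementarySplitMatroid_indep_iff h).2 hind)
    obtain ⟨i, hi, hrk, huniq⟩ := elementarySplitMatroid_exists_of_not_indep h hn hind
    have hss : S ∩ H i ⊂ S := by
      refine Finset.inter_subset_left.ssubset_of_ne fun heq => ?_
      have h1 := hS i (Finset.inter_eq_left.1 heq)
      rw [heq] at hi
      omega
    have hsum : ∑ T ∈ S.ssubsets, fordA M Finset.univ T = fordC M (S ∩ H i) := by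
      rw [← fordA_univ_sum_powerset M (S ∩ H i)]
      refine (Finset.sum_subset (fun T hT => ?_) fun T hT hT' => ?_).symm
      · exact Finset.mem_ssubsets.2 ((Finset.mem_powerset.1 hT).trans_ssubset hss)
      · have hTS := Finset.mem_ssubsets.1 hT
        refine ih T hTS (lt_of_le_of_lt ?_ hn) fun j hj => ?_
        · obtain ⟨I, hIT, hI, hcard, -⟩ := M.exists_finset_maximal_indep T
          rw [← hcard]
          exact Matroid.card_le_natRk_of_indep hI (hIT.trans hTS.subset)
        · by_contra! hlt
          have hTj := Finset.subset_inter hTS.subset hj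
          have := huniq j (hlt.trans_le (Finset.card_le_card hTj))
          exact hT' (Finset.mem_powerset.2 (this ▸ hTj))
    have h1 := fordA_univ_sum_powerset M S
    rw [← Finset.sum_erase_add _ _ (Finset.mem_powerset_self S)] at h1
    change ∑ T ∈ S.ssubsets, _ + _ = _ at h1
    rw [hsum, fordC, fordC, hrk,
      elementarySplitMatroid_natRk_of_subset h Finset.inter_subset_right hi.le] at h1
    have h2 := Finset.card_sdiff_add_card_inter S (H i)
    push_cast at h1
    omega

theorem elementarySplitMatroid_expectedCodim :
    expectedCodim (elementarySplitMatroid h) =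
      ∑ i : Fin q, ((n : ℤ) - (r i : ℤ)) * (((H i).card : ℤ) - (r i : ℤ)) := by
  have huniv : expectedCodim (elementarySplitMatroid h) =
      expectedCodimWrt (elementarySplitMatroid h) Finset.univ := by
    rw [expectedCodim]
    congr 1
    simp [elementarySplitMatroid_ground]
  rw [huniv, expectedCodimWrt, elementarySplitMatroid_natRank]
  set M := elementarySplitMatroid h with hM
  let big : Fin q → Finset (Finset (Fin d)) := fun i => (H i).powerset.filter (r i < ·.card)
  have hmem : ∀ {i S}, S ∈ big i ↔ S ⊆ H i ∧ r i < S.card := by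
    intro i S
    simp [big]
  have hdisj : ((Finset.univ : Finset (Fin q)) : Set (Fin q)).PairwiseDisjoint big := by
    intro i _ j _ hij
    refine Finset.disjoint_left.2 fun S hi hj => hij ?_
    exact h.eq_of_subset (hmem.1 hi).1 (hmem.1 hj).1 (hmem.1 hi).2.le
  rw [← Finset.sum_subset (Finset.subset_univ (Finset.univ.biUnion big)),
    Finset.sum_biUnion hdisj]
  · refine Finset.sum_congr rfl fun i _ => ?_
    have h1 : ∑ S ∈ big i, fordA M Finset.univ S = ((H i).card : ℤ) - (r i : ℤ) := by
      -- The subsets of `H i` left out have at most `r i` elements, so they are independent and add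
      -- nothing.
      have h2 : ∑ S ∈ big i, fordA M Finset.univ S =
          ∑ S ∈ (H i).powerset, fordA M Finset.univ S := by
        refine Finset.sum_subset (Finset.filter_subset _ _) fun S hS hS' => ?_
        have hSi := Finset.mem_powerset.1 hS
        refine fordA_eq_zero_of_indep M S ((elementarySplitMatroid_indep_iff h).2
          (h.indep_of_subset hSi ?_))
        by_contra! hlt
        exact hS' (hmem.2 ⟨hSi, hlt⟩)
      have h3 := h.card i
      rw [h2, fordA_univ_sum_powerset, fordC,
        elementarySplitMatroid_natRk_of_subset h subset_rfl (by omega)]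
    rw [← h1, Finset.mul_sum]
    refine Finset.sum_congr rfl fun S hS => ?_
    rw [elementarySplitMatroid_natRk_of_subset h (hmem.1 hS).1 (hmem.1 hS).2.le]
  · intro S _ hS
    have hle : M.natRk (S : Set (Fin d)) ≤ n := by
      obtain ⟨I, -, hI, hcard, -⟩ := M.exists_finset_maximal_indep S
      rw [← hcard]
      exact ((elementarySplitMatroid_indep_iff h).1 hI).1
    rcases hle.eq_or_lt with heq | hlt
    · rw [heq, sub_self, zero_mul]
    · rw [elementarySplitMatroid_fordA_eq_zero h S hlt, mul_zero]
      intro i hi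
      by_contra! hlt
      exact hS (Finset.mem_biUnion.2 ⟨i, Finset.mem_univ i, hmem.2 ⟨hi, hlt⟩⟩)

end ElementarySplit

theorem mainTheorem4 (n d q : ℕ) (H : Fin q → Finset (Fin d)) (r : Fin q → ℕ)
    (h : IsElementarySplitData n d H r) :
    naiveDim (elementarySplitMatroid h) =
        (n : ℤ) * (d : ℤ) - expectedCodim (elementarySplitMatroid h) ∧
      (n : ℤ) * (d : ℤ) - expectedCodim (elementarySplitMatroid h) =
        (n : ℤ) * (d : ℤ) - ∑ i : Fin q, ((n : ℤ) - (r i : ℤ)) * (((H i).card : ℤ) - (r i : ℤ)) ∧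
      naiveDim (elementarySplitMatroid h) = expectedDim (elementarySplitMatroid h) := by
  have hE : (elementarySplitMatroid h).E.ncard = d := by
    rw [elementarySplitMatroid_ground, Set.ncard_univ, Nat.card_eq_fintype_card, Fintype.card_fin]
  rw [naiveDim, expectedDim, elementarySplitMatroid_sum_subspaces,
    elementarySplitMatroid_expectedCodim, elementarySplitMatroid_natRank, hE]
  exact ⟨rfl, rfl, rfl⟩
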